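/- Let $T>0$, let $\mathbb T=\mathbb R/\mathbb Z$, and let $\rho_0:[0,1]\to[0,1]$ be measurable. All functions $\rho:[0,T]\times[0,1]\to[0,1]$ below are measurable and satisfy $\rho(0,u)=\rho_0(u)$ for a.e. $u$. For such $\rho$, for $t\in[0,T]$ and for $H$ of class $C^1$ in time and $C^2$ in space, put $$B_t(\rho,H)=\int_0^1\rho(t,u)H(t,u)\,du-\int_0^1\rho(0,u)H(0,u)\,du-\int_0^t\!\int_0^1\rho(s,u)\big(\partial_sH(s,u)+\partial_u^2H(s,u)\big)\,du\,ds .$$ If $\rho\in L^2(0,T;H^1(0,1))$, write $\rho_s(0),\rho_s(1)$ for the boundary values of the continuous representative of $\rho(s,\cdot)$ (defined for a.e. $s$), and put $$F_t(\rho,H)=\int_0^t\big(\rho_s(0)\,\partial_uH(s,0)-\rho_s(1)\,\partial_uH(s,1)\big)\,ds .$$ * For $\alpha>0$, $\rho$ is a weak solution of the heat equation $\partial_t\rho=\partial_u^2\rho$ with Robin boundary conditions $\partial_u\rho(t,0)=\partial_u\rho(t,1)=\alpha(\rho(t,0)-\rho(t,1))$ if $\rho\in L^2(0,T;H^1(0,1))$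 and, for all $t\in[0,T]$ and all $H\in C^{1,2}([0,T]\times[0,1])$, $$B_t(\rho,H)-F_t(\rho,H)+\int_0^t\alpha\,(\rho_s(0)-\rho_s(1))(H(s,0)-H(s,1))\,ds=0 .$$ * $\rho$ is a weak solution of the heat equation with Neumann boundary conditions $\partial_u\rho(t,0)=\partial_u\rho(t,1)=0$ if $\rho\in L^2(0,T;H^1(0,1))$ and $B_t(\rho,H)-F_t(\rho,H)=0$ for all $t\in[0,T]$ and all $H\in C^{1,2}([0,T]\times[0,1])$. * $\rho$ is a weak solution of the heat equation with periodic boundary conditions if $B_t(\rho,H)=0$ for all $t\in[0,T]$ and all $H\in C^{1,2}([0,T]\times\mathbb T)$. **Theorem (phase transition for the heat equation with Robin boundary conditions).** For each $\alpha>0$ let $\rho^\alpha$ be a weak solution of the heat equation with Robin boundary conditions of parameter $\alpha$. If $\rho^0$ is a weak solution of the heat equation with Neumann boundary conditions, then $$\lim_{\alpha\to0^+}\rho^\alpha=\rho^0\quad\text{in }L^2([0,T]\times[0,1]).$$ If $\rho^\infty$ is a weak solution of the heat equation with periodic boundary conditions, then $$\lim_{\alpha\to\infty}\rho^\alpha=\rho^\infty\quad\text{in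 }L^2([0,T]\times[0,1]).$$ Here all solutions have the same initial condition $\rho_0$. -/

import Mathlib

open MeasureTheory Set Filter Topology
open scoped ContDiff

noncomputable section

namespace RobinHeat

/-- `H` is of class `C¹` in time and `C²` in space on `[0,T] × S`, up to the boundary, with
partial derivatives `∂ₛH = Hs`, `∂ᵤH = Hu`, `∂ᵤ∂ᵤH = Huu`. The derivatives are one-sided at
boundary points. -/
structure IsC12 (T : ℝ) (S : Set ℝ) (H Hs Hu Huu : ℝ → ℝ → ℝ) : Prop where
  deriv_time : ∀ s ∈ Icc 0 T, ∀ u ∈ S,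
    HasDerivWithinAt (fun r => H r u) (Hs s u) (Icc 0 T) s
  deriv_space : ∀ s ∈ Icc 0 T, ∀ u ∈ S, HasDerivWithinAt (H s) (Hu s u) S u
  deriv_space_space : ∀ s ∈ Icc 0 T, ∀ u ∈ S, HasDerivWithinAt (Hu s) (Huu s u) S u
  cont : ContinuousOn (Function.uncurry H) (Icc 0 T ×ˢ S)
  cont_time : ContinuousOn (Function.uncurry Hs) (Icc 0 T ×ˢ S)
  cont_space : ContinuousOn (Function.uncurry Hu) (Icc 0 T ×ˢ S)
  cont_space_space : ContinuousOn (Function.uncurry Huu) (Icc 0 T ×ˢ S)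

/-- The class `C^{1,2}([0,T] × 𝕋)`, `𝕋 = ℝ/ℤ`: functions of class `C^{1,2}` on `[0,T] × ℝ`
that are `1`-periodic in space. -/
structure IsPeriodicC12 (T : ℝ) (H Hs Hu Huu : ℝ → ℝ → ℝ) : Prop where
  isC12 : IsC12 T univ H Hs Hu Huu
  periodic : ∀ s ∈ Icc 0 T, Function.Periodic (H s) 1

/-- `ζ` belongs to the Sobolev space `H¹(0,1)` and `ζ'` is its weak derivative. -/
structure HasWeakDeriv (ζ ζ' : ℝ → ℝ) : Prop where
  locallyIntegrable : LocallyIntegrableOn ζ (Ioo 0 1)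
  memLp_deriv : MemLp ζ' 2 (volume.restrict (Ioo 0 1))
  integral_eq : ∀ G : ℝ → ℝ, ContDiff ℝ ∞ G → HasCompactSupport G → tsupport G ⊆ Ioo 0 1 →
    ∫ u in (0 : ℝ)..1, deriv G u * ζ u = -∫ u in (0 : ℝ)..1, G u * ζ' u

/-- Lebesgue measure on `[0,T] × [0,1]`. -/
def rectMeasure (T : ℝ) : Measure (ℝ × ℝ) :=
  volume.restrict (Icc 0 T ×ˢ Icc 0 1)

/-- `ξ ∈ L²(0,T; H¹(0,1))`: almost every time slice has a weak derivative, and `ξ` and `∂ᵤξ`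
are square integrable on `[0,T] × [0,1]`. -/
def MemL2H1 (T : ℝ) (ξ : ℝ → ℝ → ℝ) : Prop :=
  MemLp (Function.uncurry ξ) 2 (rectMeasure T) ∧
    ∃ ξ' : ℝ → ℝ → ℝ, MemLp (Function.uncurry ξ') 2 (rectMeasure T) ∧
      ∀ᵐ t ∂(volume.restrict (Icc 0 T)), HasWeakDeriv (ξ t) (ξ' t)

/-- `f` is a representative of `ζ` that is continuous on `[0,1]`. -/
def IsContRep (ζ f : ℝ → ℝ) : Prop :=
  ContinuousOn f (Icc 0 1) ∧ f =ᵐ[volume.restrict (Icc 0 1)] ζ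

open Classical in
/-- The value at `x ∈ [0,1]` of the continuous representative of `ζ`, that is, the trace of `ζ`
at `x`. Every element of `H¹(0,1)` has a continuous representative (the value is `0` for
functions without one). -/
def trace (ζ : ℝ → ℝ) (x : ℝ) : ℝ :=
  if h : ∃ f, IsContRep ζ f then h.choose x else 0

/-- The trace does not depend on the chosen continuous representative. -/
theorem trace_eq {ζ f : ℝ → ℝ} (hf : IsContRep ζ f) {x : ℝ} (hx : x ∈ Icc (0 : ℝ) 1) :
    trace ζ x = f x := by
  have h : ∃ f, IsContRep ζ f := ⟨f, hf⟩
  have hg := h.choose_spec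
  have he : trace ζ x = h.choose x := by simp [trace, h]
  rw [he]
  exact Measure.eqOn_Icc_of_ae_eq volume zero_ne_one (hg.2.trans hf.2.symm) hg.1 hf.1 hx

/-- `ρ` is a measurable function `[0,T] × [0,1] → [0,1]` (only the values on this rectangle
matter), and it starts from `ρ₀`. -/
structure IsDensity (T : ℝ) (ρ₀ : ℝ → ℝ) (ρ : ℝ → ℝ → ℝ) : Prop where
  measurable : Measurable fun p : Icc (0 : ℝ) T × Icc (0 : ℝ) 1 => ρ p.1 p.2
  mem_Icc : ∀ t ∈ Icc 0 T, ∀ u ∈ Icc (0 : ℝ) 1, ρ t u ∈ Icc (0 : ℝ) 1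
  initial : ∀ᵐ u ∂(volume.restrict (Icc (0 : ℝ) 1)), ρ 0 u = ρ₀ u

/-- `∫ ρ(t,u) H(t,u) du - ∫ ρ(0,u) H(0,u) du - ∫₀ᵗ ∫ ρ(s,u) (∂ₛH(s,u) + ΔH(s,u)) du ds`. -/
def bulkTerm (ρ H Hs Huu : ℝ → ℝ → ℝ) (t : ℝ) : ℝ :=
  (∫ u in (0 : ℝ)..1, ρ t u * H t u) - (∫ u in (0 : ℝ)..1, ρ 0 u * H 0 u)
    - ∫ s in (0 : ℝ)..t, ∫ u in (0 : ℝ)..1, ρ s u * (Hs s u + Huu s u)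

/-- `∫₀ᵗ (ρₛ(0) ∂ᵤHₛ(0) - ρₛ(1) ∂ᵤHₛ(1)) ds`. -/
def boundaryTerm (ρ Hu : ℝ → ℝ → ℝ) (t : ℝ) : ℝ :=
  ∫ s in (0 : ℝ)..t, (trace (ρ s) 0 * Hu s 0 - trace (ρ s) 1 * Hu s 1)

/-- Weak solution on `[0,T]` of the heat equation with periodic boundary conditions. -/
structure IsWeakSolPeriodic (T : ℝ) (ρ₀ : ℝ → ℝ) (ρ : ℝ → ℝ → ℝ) : Prop where
  isDensity : IsDensity T ρ₀ ρ
  weak_eq : ∀ t ∈ Icc 0 T, ∀ H Hs Hu Huu : ℝ → ℝ → ℝ, IsPeriodicC12 T H Hs Hu Huu →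
    bulkTerm ρ H Hs Huu t = 0

/-- Weak solution on `[0,T]` of the heat equation with the Robin boundary conditions
`∂ᵤρ(t,0) = ∂ᵤρ(t,1) = α (ρ(t,0) - ρ(t,1))`. -/
structure IsWeakSolRobin (T α : ℝ) (ρ₀ : ℝ → ℝ) (ρ : ℝ → ℝ → ℝ) : Prop where
  isDensity : IsDensity T ρ₀ ρ
  memL2H1 : MemL2H1 T ρ
  weak_eq : ∀ t ∈ Icc 0 T, ∀ H Hs Hu Huu : ℝ → ℝ → ℝ, IsC12 T (Icc 0 1) H Hs Hu Huu →
    bulkTerm ρ H Hs Huu t - boundaryTerm ρ Hu t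
      + ∫ s in (0 : ℝ)..t, α * (trace (ρ s) 0 - trace (ρ s) 1) * (H s 0 - H s 1) = 0

/-- Weak solution on `[0,T]` of the heat equation with the Neumann boundary conditions
`∂ᵤρ(t,0) = ∂ᵤρ(t,1) = 0`. -/
structure IsWeakSolNeumann (T : ℝ) (ρ₀ : ℝ → ℝ) (ρ : ℝ → ℝ → ℝ) : Prop where
  isDensity : IsDensity T ρ₀ ρ
  memL2H1 : MemL2H1 T ρ
  weak_eq : ∀ t ∈ Icc 0 T, ∀ H Hs Hu Huu : ℝ → ℝ → ℝ, IsC12 T (Icc 0 1) H Hs Hu Huu →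
    bulkTerm ρ H Hs Huu t - boundaryTerm ρ Hu t = 0

/-- The norm of `ρ - ρ'` in `L²([0,T] × [0,1])`. -/
def l2Dist (T : ℝ) (ρ ρ' : ℝ → ℝ → ℝ) : ENNReal :=
  eLpNorm (fun p : ℝ × ℝ => ρ p.1 p.2 - ρ' p.1 p.2) 2 (rectMeasure T)

end RobinHeat

end

/-! Work mode by mode. Testing the weak equation on `[0,t]` against `exp (-l (t - s)) φ(u)` with
`φ'' = -l φ` removes the bulk integral, so the `defect` of the mode `φ` (how far it is from decaying
at rate `l`) consists of boundary terms only. Solutions with the same initial datum have Fourier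
coefficients differing by the difference of their defects, and Parseval turns coefficient bounds
into an `L²` bound in space, uniform in `t`. Traces lie in `[0,1]`, so boundary terms are controlled
without an energy estimate.

As `α → 0`, use the modes `cos (πnu)`. The Neumann defect vanishes, and the Robin defect contains
only the jump term, of size `O(α / n²)`; squares sum to `O(α²)`.

As `α → ∞`, use the full trigonometric system. The modes `cos (2πnu)` have zero defect for both
problems. For `sin (2πnu)` the periodic defect vanishes, and the Robin defect has two bounds: `1 /
|2πn|`, uniform in `α` and square summable, and a bound of order `1 / (1 + α)` for fixed `n`.
Dominated convergence for series concludes. -/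

namespace RobinHeat

/-! ### Parseval identities -/

open Real in
/-- Parseval's identity for the trigonometric system on `[0,1]`. -/
theorem hasSum_sq_trig {g : ℝ → ℝ} (hg : Measurable g) (hb : ∀ x, |g x| ≤ 1) :
    HasSum (fun n : ℤ => (∫ u in (0 : ℝ)..1, g u * cos (2 * π * n * u)) ^ 2
      + (∫ u in (0 : ℝ)..1, g u * sin (2 * π * n * u)) ^ 2) (∫ u in (0 : ℝ)..1, g u ^ 2) := by
  have hL2 : MemLp (fun x => (g x : ℂ)) 2 (volume.restrict (Ioc 0 1)) :=
    MemLp.of_bound (by fun_prop) 1 (ae_of_all _ fun x => by simpa using hb x)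
  have hint : ∀ φ : ℝ → ℝ, Continuous φ →
      IntervalIntegrable (fun u => g u * φ u) volume 0 1 := fun φ hφ =>
    ((intervalIntegrable_const (c := (1 : ℝ))).mono_fun' hg.aestronglyMeasurable
      (ae_of_all _ fun x => by simpa using hb x)).mul_continuousOn hφ.continuousOn
  have h := hasSum_sq_fourierCoeffOn zero_lt_one hL2
  simp only [Complex.norm_real, norm_eq_abs, sq_abs, sub_zero, inv_one, one_smul] at h
  convert h using 2 with n
  rw [fourierCoeffOn_eq_integral]
  have e : ∫ x in (0 : ℝ)..1, fourier (-n) (x : AddCircle ((1 : ℝ) - 0)) • (g x : ℂ)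
      = ((∫ u in (0 : ℝ)..1, g u * cos (2 * π * n * u) : ℝ) : ℂ)
        + ((-∫ u in (0 : ℝ)..1, g u * sin (2 * π * n * u) : ℝ) : ℂ) * Complex.I := by
    rw [Complex.ofReal_neg, ← intervalIntegral.integral_ofReal, ← intervalIntegral.integral_ofReal,
      ← intervalIntegral.integral_neg, ← intervalIntegral.integral_mul_const,
      ← intervalIntegral.integral_add]
    · refine intervalIntegral.integral_congr fun x _ => ?_
      have : (2 * π * Complex.I * (-n : ℤ) * x / ((1 - 0 : ℝ) : ℂ))
          = ((-(2 * π * n * x) : ℝ) : ℂ) * Complex.I := by push_cast; ring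
      simp only [fourier_coe_apply, smul_eq_mul]
      rw [this, Complex.exp_mul_I, ← Complex.ofReal_cos, ← Complex.ofReal_sin, cos_neg, sin_neg]
      push_cast
      ring
    · have := hint (fun u => cos (2 * π * n * u)) (by fun_prop)
      exact ⟨this.1.ofReal, this.2.ofReal⟩
    · have := hint (fun u => sin (2 * π * n * u)) (by fun_prop)
      have h' : IntervalIntegrable (fun u => ((g u * sin (2 * π * n * u) : ℝ) : ℂ)) volume 0 1 :=
        ⟨this.1.ofReal, this.2.ofReal⟩
      exact h'.neg.mul_const _
  rw [e, Complex.real_smul, norm_mul, Complex.norm_real, mul_pow, Complex.sq_norm,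
    Complex.normSq_add_mul_I]
  simp

open Real in
/-- Parseval's identity for the cosine system on `[0,1]`. -/
theorem hasSum_sq_cos {g : ℝ → ℝ} (hg : Measurable g) (hb : ∀ x, |g x| ≤ 1) :
    HasSum (fun n : ℤ => (∫ u in (0 : ℝ)..1, g u * cos (π * n * u)) ^ 2)
      (∫ u in (0 : ℝ)..1, g u ^ 2) := by
  -- Extend `g` evenly to `[-1,1]` as `g |u|`: the sine parts cancel, and the factor `1/2` in the
  -- Fourier coefficients compensates for the doubled integral over `[0,1]`.
  have hint : ∀ φ : ℝ → ℂ, Continuous φ → ∀ a b : ℝ,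
      IntervalIntegrable (fun u => φ u * (g |u| : ℂ)) volume a b := fun φ hφ a b =>
    ((intervalIntegrable_const (c := (1 : ℝ))).mono_fun'
      (Complex.measurable_ofReal.comp (hg.comp measurable_norm)).aestronglyMeasurable
      (ae_of_all _ fun x => by simpa using hb |x|)).continuousOn_mul hφ.continuousOn
  have hsplit : ∀ φ : ℝ → ℂ, Continuous φ → ∫ u in (-1 : ℝ)..1, φ u * (g |u| : ℂ)
      = ∫ u in (0 : ℝ)..1, (φ u + φ (-u)) * (g u : ℂ) := by
    intro φ hφ
    rw [← intervalIntegral.integral_add_adjacent_intervals (hint φ hφ (-1) 0) (hint φ hφ 0 1)]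
    have : ∫ u in (-1 : ℝ)..0, φ u * (g |u| : ℂ) = ∫ u in (0 : ℝ)..1, φ (-u) * (g |u| : ℂ) := by
      have := intervalIntegral.integral_comp_neg (a := 0) (b := 1)
        (fun u => φ u * (g |u| : ℂ))
      simpa using this.symm
    rw [this, ← intervalIntegral.integral_add (hint (fun u => φ (-u)) (by fun_prop) 0 1)
      (hint φ hφ 0 1)]
    refine intervalIntegral.integral_congr fun x hx => ?_
    rw [uIcc_of_le zero_le_one] at hx
    simp only [abs_of_nonneg hx.1]
    ring
  have hL2 : MemLp (fun x => (g |x| : ℂ)) 2 (volume.restrict (Ioc (-1) 1)) :=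
    MemLp.of_bound (Complex.measurable_ofReal.comp (hg.comp measurable_norm)).aestronglyMeasurable
      1 (ae_of_all _ fun x => by simpa using hb |x|)
  have h := hasSum_sq_fourierCoeffOn (by norm_num : (-1 : ℝ) < 1) hL2
  convert h using 1
  · funext n
    rw [fourierCoeffOn_eq_integral]
    simp only [smul_eq_mul]
    have hcont : Continuous fun x : ℝ => fourier (-n) (x : AddCircle ((1 : ℝ) - -1)) :=
      (fourier (-n)).continuous.comp (AddCircle.continuous_mk' _)
    have e : ∫ x in (-1 : ℝ)..1, fourier (-n) (x : AddCircle ((1 : ℝ) - -1)) * (g |x| : ℂ)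
        = ((2 * ∫ u in (0 : ℝ)..1, g u * cos (π * n * u) : ℝ) : ℂ) := by
      rw [hsplit _ hcont, ← intervalIntegral.integral_const_mul, ← intervalIntegral.integral_ofReal]
      refine intervalIntegral.integral_congr fun x _ => ?_
      have h1 : (2 * π * Complex.I * (-n : ℤ) * x / ((1 - -1 : ℝ) : ℂ))
          = ((-(π * n * x) : ℝ) : ℂ) * Complex.I := by push_cast; ring
      have h2 : (2 * π * Complex.I * (-n : ℤ) * (-x : ℝ) / ((1 - -1 : ℝ) : ℂ))
          = ((π * n * x : ℝ) : ℂ) * Complex.I := by push_cast; ring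
      simp only [fourier_coe_apply]
      rw [h1, h2, Complex.exp_mul_I, Complex.exp_mul_I, ← Complex.ofReal_cos, ← Complex.ofReal_sin,
        ← Complex.ofReal_cos, ← Complex.ofReal_sin, cos_neg, sin_neg]
      push_cast
      ring
    rw [e, Complex.real_smul, ← Complex.ofReal_mul, Complex.norm_real, norm_eq_abs, sq_abs]
    ring
  · have hsq : ∀ a b : ℝ, IntervalIntegrable (fun x => g |x| ^ 2) volume a b := fun a b =>
      (intervalIntegrable_const (c := (1 : ℝ))).mono_fun'
        ((hg.comp measurable_norm).pow_const 2).aestronglyMeasurable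
        (ae_of_all _ fun x => by simpa using hb |x|)
    have h0 : ∫ x in (-1 : ℝ)..0, g |x| ^ 2 = ∫ x in (0 : ℝ)..1, g |x| ^ 2 := by
      have := intervalIntegral.integral_comp_neg (a := 0) (b := 1) (fun x => g |x| ^ 2)
      simpa using this.symm
    have h1 : ∫ x in (0 : ℝ)..1, g |x| ^ 2 = ∫ x in (0 : ℝ)..1, g x ^ 2 :=
      intervalIntegral.integral_congr fun x hx => by
        rw [uIcc_of_le zero_le_one] at hx
        simp only [abs_of_nonneg hx.1]
    simp only [Complex.norm_real, norm_eq_abs, sq_abs]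
    rw [← intervalIntegral.integral_add_adjacent_intervals (hsq (-1) 0) (hsq 0 1), h0, h1,
      smul_eq_mul]
    ring

/-! ### Time slices, traces and the space-time distance -/

variable {T : ℝ} {ρ₀ : ℝ → ℝ} {ρ ρ' : ℝ → ℝ → ℝ}

/-- The time slice of `ρ` extended from `[0,1]` to a function on `ℝ` by its boundary values. -/
noncomputable def slice (ρ : ℝ → ℝ → ℝ) (t u : ℝ) : ℝ := ρ t (projIcc 0 1 zero_le_one u)

theorem slice_eq {t u : ℝ} (hu : u ∈ Icc (0 : ℝ) 1) : slice ρ t u = ρ t u := by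
  simp [slice, projIcc_of_mem _ hu]

/-- Measurability is assumed only on the rectangle; precomposing with the projection onto `[0,1]`
gives the globally measurable functions that the Parseval identities take. -/
theorem IsDensity.measurable_slice (h : IsDensity T ρ₀ ρ) {t : ℝ} (ht : t ∈ Icc 0 T) :
    Measurable (slice ρ t) :=
  h.measurable.comp ((measurable_const (a := (⟨t, ht⟩ : Icc (0 : ℝ) T))).prodMk
    (continuous_projIcc (h := zero_le_one)).measurable)

theorem IsDensity.slice_mem_Icc (h : IsDensity T ρ₀ ρ) {t : ℝ} (ht : t ∈ Icc 0 T) (u : ℝ) :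
    slice ρ t u ∈ Icc (0 : ℝ) 1 :=
  h.mem_Icc t ht _ (projIcc 0 1 zero_le_one u).2

theorem integral_slice (φ : ℝ → ℝ) (t : ℝ) :
    ∫ u in (0 : ℝ)..1, slice ρ t u * φ u = ∫ u in (0 : ℝ)..1, ρ t u * φ u :=
  intervalIntegral.integral_congr fun u hu => by
    rw [uIcc_of_le zero_le_one] at hu
    simp only [slice_eq hu]

theorem IsDensity.intervalIntegrable_mul (h : IsDensity T ρ₀ ρ) {t : ℝ} (ht : t ∈ Icc 0 T)
    {φ : ℝ → ℝ} (hφ : Continuous φ) :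
    IntervalIntegrable (fun u => ρ t u * φ u) volume 0 1 := by
  have : IntervalIntegrable (fun u => slice ρ t u * φ u) volume 0 1 :=
    ((intervalIntegrable_const (c := (1 : ℝ))).mono_fun'
      (h.measurable_slice ht).aestronglyMeasurable
      (ae_of_all _ fun x => by
        have := h.slice_mem_Icc ht x
        refine abs_le.2 ⟨by linarith [this.1], this.2⟩)).mul_continuousOn hφ.continuousOn
  refine this.congr fun u hu => ?_
  rw [uIoc_of_le zero_le_one] at hu
  simp only [slice_eq (Ioc_subset_Icc_self hu)]

theorem IsDensity.abs_integral_mul_le (h : IsDensity T ρ₀ ρ) {t : ℝ} (ht : t ∈ Icc 0 T)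
    {φ : ℝ → ℝ} {C : ℝ} (hφ : ∀ u ∈ Icc (0 : ℝ) 1, |φ u| ≤ C) :
    |∫ u in (0 : ℝ)..1, ρ t u * φ u| ≤ C := by
  have := intervalIntegral.norm_integral_le_of_norm_le_const (a := 0) (b := 1) (C := C)
    (f := fun u => ρ t u * φ u) fun u hu => by
      rw [uIoc_of_le zero_le_one] at hu
      have hu := Ioc_subset_Icc_self hu
      have h1 := h.mem_Icc t ht u hu
      rw [norm_mul, Real.norm_eq_abs, Real.norm_eq_abs, abs_of_nonneg h1.1]
      nlinarith [hφ u hu, abs_nonneg (φ u), h1.1, h1.2]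
  simpa using this

theorem IsDensity.integral_initial (h : IsDensity T ρ₀ ρ) (φ : ℝ → ℝ) :
    ∫ u in (0 : ℝ)..1, ρ 0 u * φ u = ∫ u in (0 : ℝ)..1, ρ₀ u * φ u := by
  refine intervalIntegral.integral_congr_ae_restrict ?_
  rw [uIoc_of_le zero_le_one]
  filter_upwards [ae_mono (Measure.restrict_mono Ioc_subset_Icc_self le_rfl) h.initial] with u hu
  rw [hu]

/-- The trace of a function with values in `[0,1]` lies in `[0,1]`. -/
theorem trace_mem_Icc {ζ : ℝ → ℝ} (hζ : ∀ u ∈ Icc (0 : ℝ) 1, ζ u ∈ Icc (0 : ℝ) 1) {x : ℝ}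
    (hx : x ∈ Icc (0 : ℝ) 1) : trace ζ x ∈ Icc (0 : ℝ) 1 := by
  by_cases h : ∃ f, IsContRep ζ f
  · obtain ⟨f, hf⟩ := h
    -- Clamping a continuous representative to `[0,1]` gives another one, and the trace does not
    -- depend on the choice.
    have hg : IsContRep ζ fun u => max 0 (min 1 (f u)) := by
      refine ⟨continuousOn_const.sup (continuousOn_const.inf hf.1), ?_⟩
      filter_upwards [hf.2, ae_restrict_mem measurableSet_Icc] with u hu hu'
      rw [hu, min_eq_right (hζ u hu').2, max_eq_right (hζ u hu').1]
    rw [trace_eq hg hx]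
    exact ⟨le_max_left _ _, max_le zero_le_one (min_le_left _ _)⟩
  -- The default value `0` also lies in `[0,1]`.
  · simp [trace, h]

theorem IsDensity.abs_trace_sub_trace_le (h : IsDensity T ρ₀ ρ) {t : ℝ} (ht : t ∈ Icc 0 T) :
    |trace (ρ t) 0 - trace (ρ t) 1| ≤ 1 := by
  have h0 := trace_mem_Icc (h.mem_Icc t ht) (left_mem_Icc.2 zero_le_one)
  have h1 := trace_mem_Icc (h.mem_Icc t ht) (right_mem_Icc.2 zero_le_one)
  rw [abs_le]
  constructor <;> linarith [h0.1, h0.2, h1.1, h1.2]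

/-- A bound on the spatial `L²` distance that is uniform in time bounds the distance in
`L²([0,T] × [0,1])`. -/
theorem l2Dist_le (hT : 0 ≤ T) {M : ℝ} (h : IsDensity T ρ₀ ρ) (h' : IsDensity T ρ₀ ρ')
    (hM : ∀ t ∈ Icc 0 T, ∫ u in (0 : ℝ)..1, (slice ρ t u - slice ρ' t u) ^ 2 ≤ M) :
    l2Dist T ρ ρ' ≤ ENNReal.ofReal (T * M) ^ (1 / 2 : ℝ) := by
  rw [l2Dist, eLpNorm_eq_lintegral_rpow_enorm_toReal (by norm_num) (by norm_num)]
  simp only [ENNReal.toReal_ofNat]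
  refine ENNReal.rpow_le_rpow ?_ (by norm_num)
  rw [rectMeasure, Measure.volume_eq_prod, ← Measure.prod_restrict]
  -- This half of Tonelli needs no joint measurability on `ℝ × ℝ`.
  refine (lintegral_prod_le _).trans ?_
  have key : ∀ t ∈ Icc 0 T, ∫⁻ u in Icc (0 : ℝ) 1, ‖ρ t u - ρ' t u‖ₑ ^ (2 : ℝ)
      ≤ ENNReal.ofReal M := by
    intro t ht
    refine le_trans (le_of_eq ?_) (ENNReal.ofReal_le_ofReal (hM t ht))
    rw [intervalIntegral.integral_of_le zero_le_one, ← integral_Icc_eq_integral_Ioc,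
      ofReal_integral_eq_lintegral_ofReal]
    · refine setLIntegral_congr_fun measurableSet_Icc fun u hu => ?_
      simp only [slice_eq hu]
      rw [← sq_abs, ENNReal.ofReal_pow (abs_nonneg _), ← Real.norm_eq_abs, ofReal_norm]
      exact_mod_cast ENNReal.rpow_natCast _ 2
    · refine Measure.integrableOn_of_bounded (M := 1) (by simp)
        (((h.measurable_slice ht).sub (h'.measurable_slice ht)).pow_const 2).aestronglyMeasurable
        (ae_of_all _ fun u => ?_)
      have h1 := h.slice_mem_Icc ht u
      have h2 := h'.slice_mem_Icc ht u
      rw [Real.norm_eq_abs, abs_pow]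
      exact pow_le_one₀ (abs_nonneg _) (abs_le.2
        ⟨by linarith [h1.1, h2.2], by linarith [h1.2, h2.1]⟩)
    · exact ae_of_all _ fun u => sq_nonneg _
  calc _ ≤ ∫⁻ _ in Icc 0 T, ENNReal.ofReal M := setLIntegral_mono' measurableSet_Icc key
    _ = ENNReal.ofReal (T * M) := by
      rw [lintegral_const, Measure.restrict_apply_univ, Real.volume_Icc, sub_zero, mul_comm,
        ENNReal.ofReal_mul hT]

/-! ### Exponentially weighted test functions and defects -/

open Real

/-- Products of an exponential in time and a `C²` function in space are of class `C^{1,2}`. -/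
theorem isC12_exp_mul (T l t : ℝ) (S : Set ℝ) {φ φ₁ φ₂ : ℝ → ℝ}
    (h₁ : ∀ u, HasDerivAt φ (φ₁ u) u) (h₂ : ∀ u, HasDerivAt φ₁ (φ₂ u) u) (h₃ : Continuous φ₂) :
    IsC12 T S (fun s u => exp (-l * (t - s)) * φ u) (fun s u => l * exp (-l * (t - s)) * φ u)
      (fun s u => exp (-l * (t - s)) * φ₁ u) (fun s u => exp (-l * (t - s)) * φ₂ u) := by
  have c₁ : Continuous φ := continuous_iff_continuousAt.2 fun u => (h₁ u).continuousAt
  have c₂ : Continuous φ₁ := continuous_iff_continuousAt.2 fun u => (h₂ u).continuousAt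
  refine ⟨fun s _ u _ => ?_, fun s _ u _ => ((h₁ u).const_mul _).hasDerivWithinAt,
    fun s _ u _ => ((h₂ u).const_mul _).hasDerivWithinAt, ?_, ?_, ?_, ?_⟩
  · have : HasDerivAt (fun r => -l * (t - r)) l s := by
      simpa using ((hasDerivAt_id s).const_sub t).const_mul (-l)
    simpa [mul_comm l] using (this.exp.mul_const (φ u)).hasDerivWithinAt
  all_goals
    refine Continuous.continuousOn ?_
    simp only [Function.uncurry_def]
    fun_prop

/-- The deviation of the mode `φ` of `ρ` from exponential decay with rate `l`. -/
noncomputable def defect (l : ℝ) (ρ : ℝ → ℝ → ℝ) (φ : ℝ → ℝ) (t : ℝ) : ℝ :=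
  (∫ u in (0 : ℝ)..1, ρ t u * φ u) - exp (-l * t) * ∫ u in (0 : ℝ)..1, ρ 0 u * φ u

/-- The weight is `1` at `s = t` and `exp (-l t)` at `s = 0`, so the endpoint terms form the defect.
The remaining integral measures the failure of `φ₂ = -l φ`. -/
theorem bulkTerm_exp_mul (l t : ℝ) (ρ : ℝ → ℝ → ℝ) (φ φ₂ : ℝ → ℝ) :
    bulkTerm ρ (fun s u => exp (-l * (t - s)) * φ u) (fun s u => l * exp (-l * (t - s)) * φ u)
      (fun s u => exp (-l * (t - s)) * φ₂ u) t
    = defect l ρ φ t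
      - ∫ s in (0 : ℝ)..t, ∫ u in (0 : ℝ)..1, ρ s u * (exp (-l * (t - s)) * (l * φ u + φ₂ u)) := by
  simp only [bulkTerm, defect, sub_self, mul_zero, exp_zero, one_mul, sub_zero]
  rw [← intervalIntegral.integral_const_mul]
  congr 2
  · refine intervalIntegral.integral_congr fun u _ => ?_
    ring
  · ext s
    refine intervalIntegral.integral_congr fun u _ => ?_
    ring

/-- The initial contributions cancel because both densities start from `ρ₀`. -/
theorem defect_sub (h : IsDensity T ρ₀ ρ) (h' : IsDensity T ρ₀ ρ') {t : ℝ} (ht : t ∈ Icc 0 T)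
    (l : ℝ) {φ : ℝ → ℝ} (hφ : Continuous φ) :
    ∫ u in (0 : ℝ)..1, (slice ρ t u - slice ρ' t u) * φ u = defect l ρ φ t - defect l ρ' φ t := by
  rw [defect, defect, h.integral_initial, h'.integral_initial, sub_sub_sub_cancel_right,
    ← intervalIntegral.integral_sub (h.intervalIntegrable_mul ht hφ)
      (h'.intervalIntegrable_mul ht hφ)]
  refine intervalIntegral.integral_congr fun u hu => ?_
  rw [uIcc_of_le zero_le_one] at hu
  simp only [slice_eq hu]
  ring

theorem integral_exp_decay_le {l t : ℝ} (hl : 0 < l) :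
    ∫ s in (0 : ℝ)..t, exp (-l * (t - s)) ≤ 1 / l := by
  have hd : ∀ s ∈ uIcc 0 t, HasDerivAt (fun r => exp (-l * (t - r)) / l) (exp (-l * (t - s))) s := by
    intro s _
    have : HasDerivAt (fun r => -l * (t - r)) l s := by
      simpa using ((hasDerivAt_id s).const_sub t).const_mul (-l)
    simpa [hl.ne'] using this.exp.div_const l
  rw [intervalIntegral.integral_eq_sub_of_hasDerivAt hd
    (Continuous.intervalIntegrable (by fun_prop) _ _)]
  simp only [sub_self, mul_zero, exp_zero]
  have : 0 ≤ exp (-l * (t - 0)) / l := by positivity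
  linarith

/-- The trace jump is at most `1`, and integrating the weight in time gains `1 / l`; this gain makes
the mode bounds square summable. -/
theorem IsDensity.abs_integral_trace_le (h : IsDensity T ρ₀ ρ) {t : ℝ} (ht : t ∈ Icc 0 T) {l : ℝ}
    (hl : 0 < l) (c : ℝ) :
    |∫ s in (0 : ℝ)..t, (trace (ρ s) 0 - trace (ρ s) 1) * (exp (-l * (t - s)) * c)| ≤ |c| / l := by
  have := intervalIntegral.norm_integral_le_of_norm_le (μ := volume) ht.1
    (f := fun s => (trace (ρ s) 0 - trace (ρ s) 1) * (exp (-l * (t - s)) * c))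
    (g := fun s => exp (-l * (t - s)) * |c|) (ae_of_all _ fun s hs => by
      rw [norm_mul, norm_mul, norm_eq_abs, norm_eq_abs, norm_eq_abs, abs_exp]
      exact mul_le_of_le_one_left (by positivity)
        (h.abs_trace_sub_trace_le ⟨hs.1.le, hs.2.trans ht.2⟩))
    (Continuous.intervalIntegrable (by fun_prop) _ _)
  refine this.trans ?_
  rw [intervalIntegral.integral_mul_const, div_eq_mul_one_div, mul_comm]
  exact mul_le_mul_of_nonneg_left (integral_exp_decay_le hl) (abs_nonneg c)

/-- Here `φ` need not be an eigenfunction: the corrected sine used for large `α` is not one. -/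
theorem IsWeakSolRobin.defect_eq {α : ℝ} (h : IsWeakSolRobin T α ρ₀ ρ) {t : ℝ} (ht : t ∈ Icc 0 T)
    (l : ℝ) {φ φ₁ φ₂ : ℝ → ℝ} (h₁ : ∀ u, HasDerivAt φ (φ₁ u) u)
    (h₂ : ∀ u, HasDerivAt φ₁ (φ₂ u) u) (h₃ : Continuous φ₂) :
    defect l ρ φ t
      = (∫ s in (0 : ℝ)..t, ∫ u in (0 : ℝ)..1, ρ s u * (exp (-l * (t - s)) * (l * φ u + φ₂ u)))
        + (∫ s in (0 : ℝ)..t, (trace (ρ s) 0 * (exp (-l * (t - s)) * φ₁ 0)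
            - trace (ρ s) 1 * (exp (-l * (t - s)) * φ₁ 1)))
        - ∫ s in (0 : ℝ)..t, (trace (ρ s) 0 - trace (ρ s) 1)
            * (exp (-l * (t - s)) * (α * (φ 0 - φ 1))) := by
  have := h.weak_eq t ht _ _ _ _ (isC12_exp_mul T l t _ h₁ h₂ h₃)
  rw [bulkTerm_exp_mul, boundaryTerm] at this
  have e : ∫ s in (0 : ℝ)..t, α * (trace (ρ s) 0 - trace (ρ s) 1)
        * (exp (-l * (t - s)) * φ 0 - exp (-l * (t - s)) * φ 1)
      = ∫ s in (0 : ℝ)..t, (trace (ρ s) 0 - trace (ρ s) 1)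
            * (exp (-l * (t - s)) * (α * (φ 0 - φ 1))) :=
    intervalIntegral.integral_congr fun s _ => by ring
  rw [e] at this
  linarith

theorem IsWeakSolNeumann.defect_eq_zero (h : IsWeakSolNeumann T ρ₀ ρ) {t : ℝ} (ht : t ∈ Icc 0 T)
    (l : ℝ) {φ φ₁ φ₂ : ℝ → ℝ} (h₁ : ∀ u, HasDerivAt φ (φ₁ u) u)
    (h₂ : ∀ u, HasDerivAt φ₁ (φ₂ u) u) (h₃ : Continuous φ₂) (hl : ∀ u, φ₂ u = -(l * φ u))
    (hφ0 : φ₁ 0 = 0) (hφ1 : φ₁ 1 = 0) : defect l ρ φ t = 0 := by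
  have := h.weak_eq t ht _ _ _ _ (isC12_exp_mul T l t _ h₁ h₂ h₃)
  rw [bulkTerm_exp_mul, boundaryTerm] at this
  simpa [hl, hφ0, hφ1] using this

theorem IsWeakSolPeriodic.defect_eq_zero (h : IsWeakSolPeriodic T ρ₀ ρ) {t : ℝ} (ht : t ∈ Icc 0 T)
    (l : ℝ) {φ φ₁ φ₂ : ℝ → ℝ} (h₁ : ∀ u, HasDerivAt φ (φ₁ u) u)
    (h₂ : ∀ u, HasDerivAt φ₁ (φ₂ u) u) (h₃ : Continuous φ₂) (hl : ∀ u, φ₂ u = -(l * φ u))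
    (hφ : Function.Periodic φ 1) : defect l ρ φ t = 0 := by
  have := h.weak_eq t ht _ _ _ _ ⟨isC12_exp_mul T l t _ h₁ h₂ h₃, fun s _ u => by simp [hφ u]⟩
  rw [bulkTerm_exp_mul] at this
  simpa [hl] using this

/-! ### Defects of the trigonometric modes -/

theorem hasDerivAt_cos_mul (c u : ℝ) :
    HasDerivAt (fun u => cos (c * u)) (-c * sin (c * u)) u := by
  simpa [mul_comm] using ((hasDerivAt_id u).const_mul c).cos

theorem hasDerivAt_sin_mul (c u : ℝ) :
    HasDerivAt (fun u => sin (c * u)) (c * cos (c * u)) u := by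
  simpa [mul_comm] using ((hasDerivAt_id u).const_mul c).sin

theorem hasDerivAt_neg_mul_sin_mul (c u : ℝ) :
    HasDerivAt (fun u => -c * sin (c * u)) (-(c ^ 2 * cos (c * u))) u :=
  ((hasDerivAt_sin_mul c u).const_mul (-c)).congr_deriv (by ring)

theorem hasDerivAt_mul_cos_mul (c u : ℝ) :
    HasDerivAt (fun u => c * cos (c * u)) (-(c ^ 2 * sin (c * u))) u :=
  ((hasDerivAt_cos_mul c u).const_mul c).congr_deriv (by ring)

theorem sin_pi_mul_int (n : ℤ) : sin (π * n) = 0 := by rw [mul_comm, sin_int_mul_pi]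

theorem sin_two_pi_mul_int (n : ℤ) : sin (2 * π * n) = 0 := by
  have := sin_int_mul_pi (2 * n)
  push_cast at this
  rw [← this]
  ring_nf

theorem cos_two_pi_mul_int (n : ℤ) : cos (2 * π * n) = 1 := by
  rw [mul_comm, cos_int_mul_two_pi]

theorem IsWeakSolNeumann.defect_cos (h : IsWeakSolNeumann T ρ₀ ρ) {t : ℝ} (ht : t ∈ Icc 0 T)
    (n : ℤ) : defect ((π * n) ^ 2) ρ (fun u => cos (π * n * u)) t = 0 :=
  h.defect_eq_zero ht _ (hasDerivAt_cos_mul _) (hasDerivAt_neg_mul_sin_mul _) (by fun_prop)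
    (fun _ => rfl) (by simp) (by simp [sin_pi_mul_int])

theorem IsWeakSolPeriodic.defect_cos (h : IsWeakSolPeriodic T ρ₀ ρ) {t : ℝ} (ht : t ∈ Icc 0 T)
    (n : ℤ) : defect ((2 * π * n) ^ 2) ρ (fun u => cos (2 * π * n * u)) t = 0 :=
  h.defect_eq_zero ht _ (hasDerivAt_cos_mul _) (hasDerivAt_neg_mul_sin_mul _) (by fun_prop)
    (fun _ => rfl) fun u => by
      rw [mul_add, mul_one, cos_add, sin_two_pi_mul_int, cos_two_pi_mul_int]; ring

theorem IsWeakSolPeriodic.defect_sin (h : IsWeakSolPeriodic T ρ₀ ρ) {t : ℝ} (ht : t ∈ Icc 0 T)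
    (n : ℤ) : defect ((2 * π * n) ^ 2) ρ (fun u => sin (2 * π * n * u)) t = 0 :=
  h.defect_eq_zero ht _ (hasDerivAt_sin_mul _) (hasDerivAt_mul_cos_mul _) (by fun_prop)
    (fun _ => rfl) fun u => by
      rw [mul_add, mul_one, sin_add, sin_two_pi_mul_int, cos_two_pi_mul_int]; ring

/-- The flux term drops since `φ'` vanishes at both ends; the jump term carries the factor `α (φ 0 -
φ 1)`, at most `2 α` in size. -/
theorem IsWeakSolRobin.abs_defect_cos_le {α : ℝ} (hα : 0 < α) (h : IsWeakSolRobin T α ρ₀ ρ) {t : ℝ}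
    (ht : t ∈ Icc 0 T) (n : ℤ) :
    |defect ((π * n) ^ 2) ρ (fun u => cos (π * n * u)) t| ≤ 2 * α / (π * n) ^ 2 := by
  have e := h.defect_eq ht ((π * n) ^ 2) (hasDerivAt_cos_mul (π * n))
    (hasDerivAt_neg_mul_sin_mul (π * n)) (by fun_prop)
  rcases eq_or_ne n 0 with rfl | hn
  -- For `n = 0` the right side is `0` by division by zero, and the claim is conservation of mass.
  · simpa using e
  · have hl : 0 < (π * n) ^ 2 := by positivity
    simp only [add_neg_cancel, mul_zero, intervalIntegral.integral_zero, sin_zero, mul_one,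
      sin_pi_mul_int, sub_self, zero_add, zero_sub] at e
    rw [e, abs_neg]
    refine (h.isDensity.abs_integral_trace_le ht hl _).trans ?_
    gcongr
    rw [abs_mul, abs_of_pos hα, mul_comm]
    gcongr
    rw [abs_le]
    constructor <;> linarith [cos_le_one 0, neg_one_le_cos 0, cos_le_one (π * n),
      neg_one_le_cos (π * n)]

/-- This mode has zero slope at both ends and equal end values, so both boundary terms vanish for
every `α`. -/
theorem IsWeakSolRobin.defect_cos_two {α : ℝ} (h : IsWeakSolRobin T α ρ₀ ρ) {t : ℝ}
    (ht : t ∈ Icc 0 T) (n : ℤ) :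
    defect ((2 * π * n) ^ 2) ρ (fun u => cos (2 * π * n * u)) t = 0 := by
  have e := h.defect_eq ht ((2 * π * n) ^ 2) (hasDerivAt_cos_mul (2 * π * n))
    (hasDerivAt_neg_mul_sin_mul (2 * π * n)) (by fun_prop)
  simpa [sin_two_pi_mul_int, cos_two_pi_mul_int] using e

/-- Equal end values remove the term with `α`; the flux has size `|c|` with `c = 2πn`, and the time
integral gains `1 / c²`. -/
theorem IsWeakSolRobin.abs_defect_sin_le {α : ℝ} (h : IsWeakSolRobin T α ρ₀ ρ) {t : ℝ}
    (ht : t ∈ Icc 0 T) (n : ℤ) :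
    |defect ((2 * π * n) ^ 2) ρ (fun u => sin (2 * π * n * u)) t| ≤ 1 / |2 * π * n| := by
  have e := h.defect_eq ht ((2 * π * n) ^ 2) (hasDerivAt_sin_mul (2 * π * n))
    (hasDerivAt_mul_cos_mul (2 * π * n)) (by fun_prop)
  rcases eq_or_ne n 0 with rfl | hn
  · simpa using e
  · have hl : 0 < (2 * π * n) ^ 2 := by positivity
    simp only [add_neg_cancel, mul_zero, intervalIntegral.integral_zero, sin_zero, mul_one,
      sin_two_pi_mul_int, sub_self, sub_zero, cos_zero, cos_two_pi_mul_int, zero_add,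
      ← sub_mul] at e
    rw [e]
    refine (h.isDensity.abs_integral_trace_le ht hl _).trans (le_of_eq ?_)
    have : |2 * π * n| ≠ 0 := by positivity
    rw [← sq_abs]
    field_simp

/-- Correcting `sin (2πnu)` by a multiple of `u - 1/2` yields a test function satisfying the Robin
boundary conditions exactly. -/
theorem IsWeakSolRobin.abs_defect_sin_le_div {α : ℝ} (hα : 0 < α) (h : IsWeakSolRobin T α ρ₀ ρ)
    {t : ℝ} (ht : t ∈ Icc 0 T) (n : ℤ) :
    |defect ((2 * π * n) ^ 2) ρ (fun u => sin (2 * π * n * u)) t|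
      ≤ |2 * π * n| / (1 + α) * (2 + (2 * π * n) ^ 2 * T) := by
  set c : ℝ := 2 * π * n with hc
  -- For `φ = sin (c u) + ε (u - 1/2)` both end slopes are `c + ε` and `φ 0 - φ 1 = -ε`; the Robin
  -- condition `c + ε = -α ε` fixes `ε`.
  set ε : ℝ := -c / (1 + α) with hε
  have hα' : 1 + α ≠ 0 := by positivity
  have hεα : c + ε = α * (-ε) := by rw [hε]; field_simp; ring
  have habs : |c| / (1 + α) = |ε| := by rw [hε, abs_div, abs_neg, abs_of_pos (by positivity : 0 < 1 + α)]
  have hlin : ∀ u : ℝ, HasDerivAt (fun u : ℝ => ε * (u - 1 / 2)) ε u := fun u =>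
    (((hasDerivAt_id u).sub_const (1 / 2)).const_mul ε).congr_deriv (mul_one ε)
  have e := h.defect_eq ht (c ^ 2) (fun u => (hasDerivAt_sin_mul c u).add (hlin u))
    (fun u => (hasDerivAt_mul_cos_mul c u).add_const ε) (by fun_prop)
  have hs : sin c = 0 := sin_two_pi_mul_int n
  have hcos : cos c = 1 := cos_two_pi_mul_int n
  -- The flux and jump integrands coincide, so the boundary terms cancel exactly, whatever the
  -- traces are.
  have hbd : (∫ s in (0 : ℝ)..t, (trace (ρ s) 0 * (exp (-c ^ 2 * (t - s)) * (c * cos (c * 0) + ε))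
            - trace (ρ s) 1 * (exp (-c ^ 2 * (t - s)) * (c * cos (c * 1) + ε))))
        = ∫ s in (0 : ℝ)..t, (trace (ρ s) 0 - trace (ρ s) 1) * (exp (-c ^ 2 * (t - s))
          * (α * (sin (c * 0) + ε * (0 - 1 / 2) - (sin (c * 1) + ε * (1 - 1 / 2))))) := by
    refine intervalIntegral.integral_congr fun s _ => ?_
    simp only [mul_zero, mul_one, cos_zero, hcos, sin_zero, hs, hεα]
    ring
  simp only [Pi.add_apply] at e
  rw [hbd, add_sub_cancel_right] at e
  have hg : ∀ u ∈ Icc (0 : ℝ) 1, |ε * (u - 1 / 2)| ≤ |ε| := fun u hu => by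
    rw [abs_mul]
    exact mul_le_of_le_one_right (abs_nonneg _)
      (abs_le.2 ⟨by linarith [hu.1], by linarith [hu.2]⟩)
  have h0T : (0 : ℝ) ∈ Icc 0 T := ⟨le_rfl, ht.1.trans ht.2⟩
  have hsum : ∀ r ∈ Icc 0 T, ∫ u in (0 : ℝ)..1, ρ r u * (sin (c * u) + ε * (u - 1 / 2))
      = (∫ u in (0 : ℝ)..1, ρ r u * sin (c * u)) + ∫ u in (0 : ℝ)..1, ρ r u * (ε * (u - 1 / 2)) := by
    intro r hr
    rw [← intervalIntegral.integral_add]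
    · simp only [mul_add]
    · exact h.isDensity.intervalIntegrable_mul hr (by fun_prop)
    · exact h.isDensity.intervalIntegrable_mul hr (by fun_prop)
  have hsplit : defect (c ^ 2) ρ (fun u => sin (c * u)) t
      = defect (c ^ 2) ρ ((fun u => sin (c * u)) + fun u => ε * (u - 1 / 2)) t
        - ((∫ u in (0 : ℝ)..1, ρ t u * (ε * (u - 1 / 2)))
          - exp (-c ^ 2 * t) * ∫ u in (0 : ℝ)..1, ρ 0 u * (ε * (u - 1 / 2))) := by
    simp only [defect, Pi.add_apply]
    rw [hsum t ht, hsum 0 h0T]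
    ring
  have hexp : ∀ s, s ≤ t → exp (-c ^ 2 * (t - s)) ≤ 1 := fun s hst =>
    exp_le_one_iff.2 (by nlinarith [sq_nonneg c])
  -- Only the bulk residue `c² ε (u - 1/2)` of the linear correction survives. The defect of the
  -- correction itself adds at most `2 |ε|`, by `b2` and `b3`.
  have b1 : |defect (c ^ 2) ρ ((fun u => sin (c * u)) + fun u => ε * (u - 1 / 2)) t|
      ≤ c ^ 2 * |ε| * T := by
    rw [e]
    have := intervalIntegral.norm_integral_le_of_norm_le_const (a := 0) (b := t) (C := c ^ 2 * |ε|)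
      (f := fun s => ∫ u in (0 : ℝ)..1, ρ s u * (exp (-c ^ 2 * (t - s)) *
        (c ^ 2 * (sin (c * u) + ε * (u - 1 / 2)) + -(c ^ 2 * sin (c * u))))) fun s hs => by
        rw [uIoc_of_le ht.1] at hs
        refine h.isDensity.abs_integral_mul_le ⟨hs.1.le, hs.2.trans ht.2⟩ fun u hu => ?_
        have : c ^ 2 * (sin (c * u) + ε * (u - 1 / 2)) + -(c ^ 2 * sin (c * u))
          = c ^ 2 * (ε * (u - 1 / 2)) := by ring
        rw [this, abs_mul, abs_exp, abs_mul (c ^ 2), abs_of_nonneg (sq_nonneg c)]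
        exact (mul_le_of_le_one_left (by positivity) (hexp s hs.2)).trans
          (mul_le_mul_of_nonneg_left (hg u hu) (sq_nonneg c))
    rw [sub_zero, abs_of_nonneg ht.1] at this
    exact this.trans (mul_le_mul_of_nonneg_left ht.2 (by positivity))
  have b2 := h.isDensity.abs_integral_mul_le ht hg
  have b3 : |exp (-c ^ 2 * t) * ∫ u in (0 : ℝ)..1, ρ 0 u * (ε * (u - 1 / 2))| ≤ |ε| := by
    rw [abs_mul, abs_exp]
    refine (mul_le_of_le_one_left (abs_nonneg _) ?_).trans (h.isDensity.abs_integral_mul_le h0T hg)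
    simpa using hexp 0 ht.1
  rw [hsplit, habs]
  refine (abs_sub _ _).trans ?_
  have := abs_sub (∫ u in (0 : ℝ)..1, ρ t u * (ε * (u - 1 / 2)))
    (exp (-c ^ 2 * t) * ∫ u in (0 : ℝ)..1, ρ 0 u * (ε * (u - 1 / 2)))
  linarith

/-! ### Summing the mode bounds -/

theorem abs_slice_sub_slice_le (h : IsDensity T ρ₀ ρ) (h' : IsDensity T ρ₀ ρ') {t : ℝ}
    (ht : t ∈ Icc 0 T) (u : ℝ) : |slice ρ t u - slice ρ' t u| ≤ 1 := by
  have h1 := h.slice_mem_Icc ht u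
  have h2 := h'.slice_mem_Icc ht u
  exact abs_le.2 ⟨by linarith [h1.1, h2.2], by linarith [h1.2, h2.1]⟩

theorem summable_sq_div_sq : Summable fun n : ℤ => (2 / (π * n) ^ 2) ^ 2 := by
  refine ((Real.summable_one_div_int_pow (p := 4)).2 (by norm_num)).mul_left (4 / π ^ 4) |>.congr
    fun n => ?_
  rw [div_mul_div_comm, div_pow]
  ring_nf

theorem summable_sq_one_div : Summable fun n : ℤ => (1 / |2 * π * n|) ^ 2 := by
  refine ((Real.summable_one_div_int_pow (p := 2)).2 (by norm_num)).mul_left (1 / (2 * π) ^ 2)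
    |>.congr fun n => ?_
  rw [div_mul_div_comm, div_pow, sq_abs]
  ring_nf

theorem integral_sq_slice_sub_neumann_le {α : ℝ} (hα : 0 < α) (h : IsWeakSolRobin T α ρ₀ ρ)
    (h' : IsWeakSolNeumann T ρ₀ ρ') {t : ℝ} (ht : t ∈ Icc 0 T) :
    ∫ u in (0 : ℝ)..1, (slice ρ t u - slice ρ' t u) ^ 2
      ≤ α ^ 2 * ∑' n : ℤ, (2 / (π * n) ^ 2) ^ 2 := by
  refine hasSum_le (fun n => ?_) (hasSum_sq_cos
    ((h.isDensity.measurable_slice ht).sub (h'.isDensity.measurable_slice ht))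
    (abs_slice_sub_slice_le h.isDensity h'.isDensity ht)) (summable_sq_div_sq.hasSum.mul_left _)
  rw [defect_sub h.isDensity h'.isDensity ht ((π * n) ^ 2) (φ := fun u => cos (π * n * u))
    (by fun_prop), h'.defect_cos ht, sub_zero, ← mul_pow]
  refine sq_le_sq' ?_ ?_ <;>
  · have := abs_le.1 (h.abs_defect_cos_le hα ht n)
    rw [← mul_div_assoc, mul_comm α]
    linarith [this.1, this.2]

/-- Bound on the squared `n`-th Fourier coefficient of the difference of the Robin solution with
parameter `α` and the periodic solution. -/
noncomputable def periodicBound (T α : ℝ) (n : ℤ) : ℝ :=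
  min (1 / |2 * π * n|) (|2 * π * n| / (1 + α) * (2 + (2 * π * n) ^ 2 * T)) ^ 2

theorem periodicBound_le (hT : 0 ≤ T) {α : ℝ} (hα : 0 < α) (n : ℤ) :
    periodicBound T α n ≤ (1 / |2 * π * n|) ^ 2 :=
  pow_le_pow_left₀ (le_min (by positivity) (by positivity)) (min_le_left _ _) 2

theorem periodicBound_nonneg (T α : ℝ) (n : ℤ) : 0 ≤ periodicBound T α n := sq_nonneg _

theorem tendsto_periodicBound (T : ℝ) (n : ℤ) :
    Tendsto (fun α => periodicBound T α n) atTop (𝓝 0) := by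
  have h : Tendsto (fun α : ℝ => |2 * π * n| / (1 + α) * (2 + (2 * π * n) ^ 2 * T)) atTop (𝓝 0) := by
    simpa using ((tendsto_atTop_add_const_left atTop (1 : ℝ) tendsto_id).const_div_atTop
      |2 * π * n|).mul_const (2 + (2 * π * n) ^ 2 * T)
  have h' := ((tendsto_const_nhds (x := 1 / |2 * π * n|)).min h).pow 2
  rwa [min_eq_right (by positivity), zero_pow two_ne_zero] at h'

/-- The first entry of the minimum dominates uniformly in `α`; the second tends to `0` for each `n`
but grows with `|n|`, so both are needed. -/
theorem tendsto_tsum_periodicBound (hT : 0 ≤ T) :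
    Tendsto (fun α => ∑' n, periodicBound T α n) atTop (𝓝 0) := by
  have := tendsto_tsum_of_dominated_convergence summable_sq_one_div
    (tendsto_periodicBound T) (by
      filter_upwards [eventually_gt_atTop 0] with α hα n
      rw [norm_eq_abs, abs_of_nonneg (periodicBound_nonneg _ _ _)]
      exact periodicBound_le hT hα n)
  simpa using this

theorem integral_sq_slice_sub_periodic_le {α : ℝ} (hα : 0 < α) (h : IsWeakSolRobin T α ρ₀ ρ)
    (h' : IsWeakSolPeriodic T ρ₀ ρ') {t : ℝ} (ht : t ∈ Icc 0 T) :
    ∫ u in (0 : ℝ)..1, (slice ρ t u - slice ρ' t u) ^ 2 ≤ ∑' n, periodicBound T α n := by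
  have hT : 0 ≤ T := ht.1.trans ht.2
  refine hasSum_le (fun n => ?_) (hasSum_sq_trig
    ((h.isDensity.measurable_slice ht).sub (h'.isDensity.measurable_slice ht))
    (abs_slice_sub_slice_le h.isDensity h'.isDensity ht))
    (summable_sq_one_div.of_nonneg_of_le (periodicBound_nonneg T α)
      (periodicBound_le hT hα)).hasSum
  rw [defect_sub h.isDensity h'.isDensity ht ((2 * π * n) ^ 2) (φ := fun u => cos (2 * π * n * u))
      (by fun_prop), h'.defect_cos ht, h.defect_cos_two ht,
    defect_sub h.isDensity h'.isDensity ht ((2 * π * n) ^ 2) (φ := fun u => sin (2 * π * n * u))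
      (by fun_prop), h'.defect_sin ht, sub_zero, sub_zero, zero_pow two_ne_zero, zero_add,
    ← sq_abs]
  exact pow_le_pow_left₀ (abs_nonneg _)
    (le_min (h.abs_defect_sin_le ht n) (h.abs_defect_sin_le_div hα ht n)) 2

theorem tendsto_ofReal_mul_rpow {l : Filter ℝ} {M : ℝ → ℝ} (T : ℝ) (hM : Tendsto M l (𝓝 0)) :
    Tendsto (fun α => ENNReal.ofReal (T * M α) ^ (1 / 2 : ℝ)) l (𝓝 0) := by
  have h := (ENNReal.tendsto_ofReal (hM.const_mul T)).ennrpow_const (1 / 2 : ℝ)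
  simpa using h

end RobinHeat

theorem theorem3p2 (T : ℝ) (hT : 0 < T) (ρ₀ : ℝ → ℝ)
    (hρ₀_meas : Measurable fun u : Set.Icc (0 : ℝ) 1 => ρ₀ u)
    (hρ₀ : ∀ u ∈ Set.Icc (0 : ℝ) 1, ρ₀ u ∈ Set.Icc (0 : ℝ) 1)
    (ρ : ℝ → ℝ → ℝ → ℝ)
    (hρ : ∀ α : ℝ, 0 < α → RobinHeat.IsWeakSolRobin T α ρ₀ (ρ α)) :
    (∀ ρN : ℝ → ℝ → ℝ, RobinHeat.IsWeakSolNeumann T ρ₀ ρN →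
      Filter.Tendsto (fun α => RobinHeat.l2Dist T (ρ α) ρN) (nhdsWithin 0 (Set.Ioi 0)) (nhds 0)) ∧
    (∀ ρP : ℝ → ℝ → ℝ, RobinHeat.IsWeakSolPeriodic T ρ₀ ρP →
      Filter.Tendsto (fun α => RobinHeat.l2Dist T (ρ α) ρP) Filter.atTop (nhds 0)) := by
  refine ⟨fun ρN hN => ?_, fun ρP hP => ?_⟩
  · have hM : Filter.Tendsto (fun α : ℝ => α ^ 2 * ∑' n : ℤ, (2 / (Real.pi * n) ^ 2) ^ 2)
        (nhdsWithin 0 (Set.Ioi 0)) (nhds 0) := by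
      have : Continuous fun α : ℝ => α ^ 2 * ∑' n : ℤ, (2 / (Real.pi * n) ^ 2) ^ 2 := by fun_prop
      simpa using (this.tendsto 0).mono_left nhdsWithin_le_nhds
    refine tendsto_of_tendsto_of_tendsto_of_le_of_le' tendsto_const_nhds
      (RobinHeat.tendsto_ofReal_mul_rpow T hM) (Filter.Eventually.of_forall fun _ => zero_le) ?_
    filter_upwards [self_mem_nhdsWithin] with α hα
    exact RobinHeat.l2Dist_le hT.le (hρ α hα).isDensity hN.isDensity fun t ht =>
      RobinHeat.integral_sq_slice_sub_neumann_le hα (hρ α hα) hN ht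
  · refine tendsto_of_tendsto_of_tendsto_of_le_of_le' tendsto_const_nhds
      (RobinHeat.tendsto_ofReal_mul_rpow T (RobinHeat.tendsto_tsum_periodicBound hT.le))
      (Filter.Eventually.of_forall fun _ => zero_le) ?_
    filter_upwards [Filter.eventually_gt_atTop 0] with α hα
    exact RobinHeat.l2Dist_le hT.le (hρ α hα).isDensity hP.isDensity fun t ht =>
      RobinHeat.integral_sq_slice_sub_periodic_le hα (hρ α hα) hP ht
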